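/- Let $P$ be the HOMFLY polynomial of oriented links: the invariant of (nonempty) oriented links with values in $\mathbb{C}[l^{\pm1},m^{\pm1}]$ that is determined by $P(\bigcirc)=1$ and by the skein relation $l\,P(L_+)+l^{-1}P(L_-)+m\,P(L_0)=0$ for oriented links $L_+,L_-,L_0$ whose diagrams coincide except near one crossing, which is positive, negative and smoothed, respectively. Let $n\ge 1$, let $x_1,\dots,x_{n-1}$ be the Artin generators of the braid group $\mathcal{B}_n$ on $n$ strands, with the convention that the crossing of $x_i$ is negative (and that of $x_i^{-1}$ positive). Fix $k\ge 0$ and $i_1,\dots,i_k\in\{1,\dots,n-1\}$, and for $(a_1,\dots,a_k)\in\mathbb{Z}^k$ let $P_n(a_1,\dots,a_k)$ be the HOMFLY polynomial of the closure of the $n$-braid $x_{i_1}^{a_1}x_{i_2}^{a_2}\cdots x_{i_k}^{a_k}$. Then for all $a_1,\dots,a_k\in\mathbb{Z}$ and every $j\in\{1,\dots,k\}$ $$P_n(a_1,\dots,a_j+2,\dots,a_k)+ml\,P_n(a_1,\dots,a_j+1,\dots,a_k)+l^2P_n(a_1,\dots,a_j,\dots,a_k)=0.$$ Consequently $(P_n(a_1,\dots,a_k))_{(a_1,\dots,a_k)\in\mathbb{Z}^k}$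 is a multiple Fibonacci sequence with parameters $(-ml,-l^2)$, i.e. for every $j$ and all $a_1,\dots,a_k\in\mathbb{Z}$ one has $P_n(\dots,a_j+2,\dots)=-ml\,P_n(\dots,a_j+1,\dots)-l^2P_n(\dots,a_j,\dots)$. -/

import Mathlib

open scoped LaurentPolynomial

namespace Homfly

/-- The ring `ℂ[l^{±1}, m^{±1}]` of Laurent polynomials in two variables. -/
abbrev Coeff : Type := ℂ[T;T⁻¹][T;T⁻¹]

/-- The variable `l`. -/
noncomputable def l : Coeff := LaurentPolynomial.C (LaurentPolynomial.T 1)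

/-- The inverse `l⁻¹` of the variable `l`. -/
noncomputable def lInv : Coeff := LaurentPolynomial.C (LaurentPolynomial.T (-1))

/-- The variable `m`. -/
noncomputable def m : Coeff := LaurentPolynomial.T 1

/-- The inverse `m⁻¹` of the variable `m`. -/
noncomputable def mInv : Coeff := LaurentPolynomial.T (-1)

theorem l_mul_lInv : l * lInv = 1 := by
  rw [l, lInv, ← map_mul, ← LaurentPolynomial.T_add]; simp

theorem m_mul_mInv : m * mInv = 1 := by
  rw [m, mInv, ← LaurentPolynomial.T_add]; simp

/-- Artin's relations between the generators `x_0, …, x_{n-1}`: far commutativity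
`x_i x_j = x_j x_i` for `|i - j| ≥ 2` and the braid relation `x_i x_j x_i = x_j x_i x_j` for
`j = i + 1`. -/
inductive ArtinRel (n : ℕ) : FreeGroup (Fin n) → Prop
  | comm (i j : Fin n) (h : (i : ℕ) + 1 < j) :
      ArtinRel n (FreeGroup.of i * FreeGroup.of j * (FreeGroup.of j * FreeGroup.of i)⁻¹)
  | braid (i j : Fin n) (h : (i : ℕ) + 1 = j) :
      ArtinRel n (FreeGroup.of i * FreeGroup.of j * FreeGroup.of i *
        (FreeGroup.of j * FreeGroup.of i * FreeGroup.of j)⁻¹)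

/-- Artin's braid group on `n + 1` strands, with generators `x_0, …, x_{n-1}`
(so that the usual `B_n`, for `n ≥ 1` strands, is `Braid (n - 1)`). -/
abbrev Braid (n : ℕ) : Type := PresentedGroup {w : FreeGroup (Fin n) | ArtinRel n w}

/-- The Artin generator `x_i` of the braid group on `n + 1` strands; it interchanges the strands at
the positions `i` and `i + 1` by one crossing. -/
def x {n : ℕ} (i : Fin n) : Braid n := PresentedGroup.of i

theorem x_comm {n : ℕ} (i j : Fin n) (h : (i : ℕ) + 1 < j) : x i * x j = x j * x i :=
  PresentedGroup.mk_eq_mk_of_mul_inv_mem (ArtinRel.comm i j h)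

theorem x_braid {n : ℕ} (i j : Fin n) (h : (i : ℕ) + 1 = j) :
    x i * x j * x i = x j * x i * x j :=
  PresentedGroup.mk_eq_mk_of_mul_inv_mem (ArtinRel.braid i j h)

/-- A group homomorphism out of the braid group from elements that satisfy Artin's relations. -/
def braidLift {n : ℕ} {G : Type*} [Group G] (f : Fin n → G)
    (hc : ∀ i j : Fin n, (i : ℕ) + 1 < j → f i * f j = f j * f i)
    (hb : ∀ i j : Fin n, (i : ℕ) + 1 = j → f i * f j * f i = f j * f i * f j) : Braid n →* G :=
  PresentedGroup.toGroup (f := f) (by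
    rintro w (⟨i, j, h⟩ | ⟨i, j, h⟩)
    · simp only [map_mul, map_inv, FreeGroup.lift_apply_of]
      rw [mul_inv_eq_one]; exact hc i j h
    · simp only [map_mul, map_inv, FreeGroup.lift_apply_of]
      rw [mul_inv_eq_one]; exact hb i j h)

@[simp] theorem braidLift_x {n : ℕ} {G : Type*} [Group G] (f : Fin n → G) (hc) (hb) (i : Fin n) :
    braidLift f hc hb (x i) = f i := PresentedGroup.toGroup.of _

/-- The inclusion of braid groups that adds one more vertical strand on the right. -/
def addStrand (n : ℕ) : Braid n →* Braid (n + 1) :=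
  braidLift (fun i => x i.castSucc) (fun i j h => x_comm _ _ (by simpa using h))
    (fun i j h => x_braid _ _ (by simpa using h))

@[simp] theorem addStrand_x {n : ℕ} (i : Fin n) : addStrand n (x i) = x i.castSucc :=
  braidLift_x _ _ _ i

/-- The elementary moves between closed braids: conjugation in a braid group and
(de)stabilization with a crossing of either sign. -/
inductive MarkovMove : (Σ n, Braid n) → (Σ n, Braid n) → Prop
  | conj {n : ℕ} (α β : Braid n) : MarkovMove ⟨n, α * β * α⁻¹⟩ ⟨n, β⟩
  | stab {n : ℕ} (β : Braid n) : MarkovMove ⟨n + 1, addStrand n β * x (Fin.last n)⟩ ⟨n, β⟩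
  | stabInv {n : ℕ} (β : Braid n) :
      MarkovMove ⟨n + 1, addStrand n β * (x (Fin.last n))⁻¹⟩ ⟨n, β⟩

/-- Nonempty oriented links up to isotopy, presented as closed braids: by Alexander's theorem every
oriented link is the closure of a braid, and by Markov's theorem two braids have isotopic closures
if and only if they are related by the equivalence relation that the Markov moves generate. -/
def OrientedLink : Type := Quot MarkovMove

/-- The closure of a braid on `n + 1` strands. -/
def closure {n : ℕ} (β : Braid n) : OrientedLink := Quot.mk _ ⟨n, β⟩

/-- The defining properties of the HOMFLY polynomial, as an invariant of oriented links: the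
normalization (the closure of the braid on one strand is the unknot) and the skein relation
`l P(L₊) + l⁻¹ P(L₋) + m P(L₀) = 0` for oriented links with diagrams that differ at one crossing
only. The Artin generator `x_i` is a negative crossing, so a triple `L₊`, `L₋`,
`L₀` consists of the closures of `α x_i⁻¹ β`, `α x_i β` and `α β`.
Any invariant of oriented links that satisfies the normalization and the skein relation for all
diagrams has these properties, and they determine it (`existsUnique_isHomfly` below). -/
structure IsHomfly (P : OrientedLink → Coeff) : Prop where
  unknot : P (closure (1 : Braid 0)) = 1
  skein : ∀ {n : ℕ} (i : Fin n) (α β : Braid n),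
    l * P (closure (α * (x i)⁻¹ * β)) + lInv * P (closure (α * x i * β))
      + m * P (closure (α * β)) = 0

/-- A family of elements of a commutative ring that is indexed by `ℤ^k` is a multiple Fibonacci
sequence with parameters `(α, β)` if in each of the `k` indices it satisfies the recurrence
`f(…, a_j + 2, …) = α f(…, a_j + 1, …) + β f(…, a_j, …)`. -/
def IsMultipleFibonacci {R : Type*} [CommRing R] {k : ℕ} (α β : R) (f : (Fin k → ℤ) → R) : Prop :=
  ∀ (a : Fin k → ℤ) (j : Fin k),
    f (Function.update a j (a j + 2)) = α * f (Function.update a j (a j + 1)) + β * f a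

/-! Existence and uniqueness of the HOMFLY polynomial, through the Hecke algebras and the Ocneanu
trace. Nothing from here to `existsUnique_isHomfly` enters the definitions. -/

section Descending

variable {S : Type*} [Monoid S] (g : ℕ → S)

/-- The descending product `g (k+t-1) * … * g (k+1) * g k` of `t` factors. -/
def dprod (k : ℕ) : ℕ → S
  | 0 => 1
  | t + 1 => g (k + t) * dprod k t

theorem dprod_bottom (k t : ℕ) : dprod g k (t + 1) = dprod g (k + 1) t * g k := by
  induction t with
  | zero => simp [dprod]
  | succ t ih =>
    rw [dprod, ih, dprod, mul_assoc, show k + 1 + t = k + (t + 1) by omega]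

theorem dprod_comm (hc : ∀ i j, i + 1 < j → g i * g j = g j * g i) (k t i : ℕ) (h : i + 1 < k) :
    dprod g k t * g i = g i * dprod g k t := by
  induction t with
  | zero => simp [dprod]
  | succ t ih => rw [dprod, mul_assoc, ih, ← mul_assoc, ← hc i (k + t) (by omega), mul_assoc]

theorem dprod_shift (hc : ∀ i j, i + 1 < j → g i * g j = g j * g i)
    (hb : ∀ i, g i * g (i + 1) * g i = g (i + 1) * g i * g (i + 1)) (t k j : ℕ) (h1 : k ≤ j)
    (h2 : j + 1 < k + t) : dprod g k t * g (j + 1) = g j * dprod g k t := by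
  induction t generalizing k with
  | zero => omega
  | succ t ih =>
    rcases h1.eq_or_lt with rfl | h
    · obtain ⟨s, rfl⟩ : ∃ s, t = s + 1 := ⟨t - 1, by omega⟩
      rw [dprod_bottom, dprod_bottom, mul_assoc, mul_assoc, ← mul_assoc (g (k + 1)), ← hb,
        mul_assoc, ← mul_assoc, dprod_comm g hc _ _ _ (by omega), mul_assoc, mul_assoc]
    · rw [dprod_bottom, mul_assoc, hc k (j + 1) (by omega), ← mul_assoc, ih _ h (by omega),
        mul_assoc]

end Descending

section Hecke

variable {R : Type} [CommRing R] (a b : R)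

/-- The defining relations of the Hecke algebra: Artin's relations and `g² = a g + b`. -/
inductive HeckeRel (n : ℕ) : FreeAlgebra R (Fin n) → FreeAlgebra R (Fin n) → Prop
  | comm (i j : Fin n) (h : (i : ℕ) + 1 < j) : HeckeRel n
      (FreeAlgebra.ι R i * FreeAlgebra.ι R j) (FreeAlgebra.ι R j * FreeAlgebra.ι R i)
  | braid (i j : Fin n) (h : (i : ℕ) + 1 = j) : HeckeRel n
      (FreeAlgebra.ι R i * FreeAlgebra.ι R j * FreeAlgebra.ι R i)
      (FreeAlgebra.ι R j * FreeAlgebra.ι R i * FreeAlgebra.ι R j)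
  | quad (i : Fin n) : HeckeRel n (FreeAlgebra.ι R i * FreeAlgebra.ι R i)
      (a • FreeAlgebra.ι R i + b • 1)

/-- The Hecke algebra with generators `g_0, …, g_{n-1}`. -/
abbrev Hecke (n : ℕ) : Type := RingQuot (HeckeRel a b n)

/-- The generators of the Hecke algebra. -/
noncomputable def hg {n : ℕ} (i : Fin n) : Hecke a b n :=
  RingQuot.mkAlgHom R (HeckeRel a b n) (FreeAlgebra.ι R i)

variable {a b}

theorem hg_comm {n : ℕ} (i j : Fin n) (h : (i : ℕ) + 1 < j) :
    hg a b i * hg a b j = hg a b j * hg a b i := by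
  simpa [hg] using RingQuot.mkAlgHom_rel R (HeckeRel.comm (a := a) (b := b) i j h)

theorem hg_braid {n : ℕ} (i j : Fin n) (h : (i : ℕ) + 1 = j) :
    hg a b i * hg a b j * hg a b i = hg a b j * hg a b i * hg a b j := by
  simpa [hg] using RingQuot.mkAlgHom_rel R (HeckeRel.braid (a := a) (b := b) i j h)

theorem hg_quad {n : ℕ} (i : Fin n) : hg a b i * hg a b i = a • hg a b i + b • 1 := by
  simpa [hg] using RingQuot.mkAlgHom_rel R (HeckeRel.quad (a := a) (b := b) i)

/-- Algebra homomorphisms out of the Hecke algebra. -/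
noncomputable def heckeLift {n : ℕ} {A : Type*} [Ring A] [Algebra R A] (f : Fin n → A)
    (hc : ∀ i j : Fin n, (i : ℕ) + 1 < j → f i * f j = f j * f i)
    (hb : ∀ i j : Fin n, (i : ℕ) + 1 = j → f i * f j * f i = f j * f i * f j)
    (hq : ∀ i, f i * f i = a • f i + b • 1) : Hecke a b n →ₐ[R] A :=
  RingQuot.liftAlgHom R ⟨FreeAlgebra.lift R f, by
    rintro _ _ (⟨i, j, h⟩ | ⟨i, j, h⟩ | i)
    · simpa using hc i j h
    · simpa using hb i j h
    · simpa using hq i⟩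

@[simp] theorem heckeLift_hg {n : ℕ} {A : Type*} [Ring A] [Algebra R A] (f : Fin n → A)
    (hc) (hb) (hq) (i : Fin n) : heckeLift (a := a) (b := b) f hc hb hq (hg a b i) = f i := by
  rw [heckeLift, hg, RingQuot.liftAlgHom_mkAlgHom_apply, FreeAlgebra.lift_ι_apply]

theorem hecke_induction {n : ℕ} (p : Hecke a b n → Prop) (hs : ∀ r, p (algebraMap R _ r))
    (hg' : ∀ i, p (hg a b i)) (hadd : ∀ y z, p y → p z → p (y + z))
    (hmul : ∀ y z, p y → p z → p (y * z)) (y : Hecke a b n) : p y := by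
  obtain ⟨y, rfl⟩ := RingQuot.mkAlgHom_surjective R (HeckeRel a b n) y
  induction y using FreeAlgebra.induction with
  | grade0 r => rw [AlgHom.commutes]; exact hs r
  | grade1 i => exact hg' i
  | mul y z hy hz => rw [map_mul]; exact hmul _ _ hy hz
  | add y z hy hz => rw [map_add]; exact hadd _ _ hy hz

theorem heckeHom_ext {n : ℕ} {A : Type*} [Ring A] [Algebra R A] {φ ψ : Hecke a b n →ₐ[R] A}
    (h : ∀ i, φ (hg a b i) = ψ (hg a b i)) : φ = ψ := by
  refine AlgHom.ext fun y => ?_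
  refine hecke_induction (fun y => φ y = ψ y) (fun r => ?_) h (fun y z hy hz => ?_)
    (fun y z hy hz => ?_) y
  · simp
  · simp [hy, hz]
  · simp [hy, hz]

variable (a b) in
/-- The generators, indexed by all natural numbers (zero out of range). -/
noncomputable def hgn (n i : ℕ) : Hecke a b n := if h : i < n then hg a b ⟨i, h⟩ else 0

theorem hgn_val {n : ℕ} (i : Fin n) : hgn a b n i = hg a b i := by simp [hgn]

theorem hgn_comm (n i j : ℕ) (h : i + 1 < j) :
    hgn a b n i * hgn a b n j = hgn a b n j * hgn a b n i := by
  by_cases hj : j < n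
  · rw [hgn, hgn, dif_pos hj, dif_pos (by omega : i < n)]; exact hg_comm _ _ h
  · simp [hgn, hj]

theorem hgn_braid (n i : ℕ) :
    hgn a b n i * hgn a b n (i + 1) * hgn a b n i =
      hgn a b n (i + 1) * hgn a b n i * hgn a b n (i + 1) := by
  by_cases hj : i + 1 < n
  · rw [hgn, hgn, dif_pos hj, dif_pos (by omega : i < n)]; exact hg_braid _ _ rfl
  · simp [hgn, hj]

theorem hgn_quad {n i : ℕ} (h : i < n) :
    hgn a b n i * hgn a b n i = a • hgn a b n i + b • 1 := by
  rw [hgn, dif_pos h]; exact hg_quad _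

variable (a b) in
/-- The inclusion of Hecke algebras. -/
noncomputable def hInc (n : ℕ) : Hecke a b n →ₐ[R] Hecke a b (n + 1) :=
  heckeLift (fun i => hg a b i.castSucc) (fun i j h => hg_comm _ _ (by simpa using h))
    (fun i j h => hg_braid _ _ (by simpa using h)) (fun i => hg_quad _)

@[simp] theorem hInc_hg {n : ℕ} (i : Fin n) : hInc a b n (hg a b i) = hg a b i.castSucc := by
  simp [hInc]

theorem hInc_hgn {n i : ℕ} (h : i < n) : hInc a b n (hgn a b n i) = hgn a b (n + 1) i := by
  rw [hgn, dif_pos h, hgn, dif_pos (by omega : i < n + 1), hInc_hg]; rfl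

/-- The operators of right multiplication by the generators, in coordinates with respect to the
coset basis `dprod g k (n + 1 - k)`, `k = 0, …, n + 1`. -/
noncomputable def cosetOp (n : ℕ) (i : Fin (n + 1)) :
    Module.End R (Fin (n + 2) → Hecke a b n) where
  toFun v k :=
    if k = i.succ then v i.castSucc
    else if k = i.castSucc then a • v k + b • v i.succ
    else if (i : ℕ) < k then hgn a b n i * v k
    else hgn a b n (i - 1) * v k
  map_add' v w := by
    funext k
    simp only [Pi.add_apply]
    split_ifs <;> (simp only [smul_add, mul_add]; try abel)
  map_smul' r v := by
    funext k
    simp only [Pi.smul_apply, RingHom.id_apply]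
    split_ifs <;> simp only [smul_add, mul_smul_comm, smul_comm r]

theorem cosetOp_apply (n : ℕ) (i : Fin (n + 1)) (v : Fin (n + 2) → Hecke a b n)
    (k : Fin (n + 2)) : cosetOp n i v k =
    if k = i.succ then v i.castSucc
    else if k = i.castSucc then a • v k + b • v i.succ
    else if (i : ℕ) < k then hgn a b n i * v k
    else hgn a b n (i - 1) * v k := rfl

theorem cosetOp_one {n i : ℕ} (hi : i < n + 1) (v : Fin (n + 2) → Hecke a b n)
    (h : i + 1 < n + 2) : cosetOp n ⟨i, hi⟩ v ⟨i + 1, h⟩ = v ⟨i, by omega⟩ := by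
  simp [cosetOp_apply]

theorem cosetOp_two {n i : ℕ} (hi : i < n + 1) (v : Fin (n + 2) → Hecke a b n)
    (h : i < n + 2) : cosetOp n ⟨i, hi⟩ v ⟨i, h⟩ =
      a • v ⟨i, h⟩ + b • v ⟨i + 1, by omega⟩ := by
  simp [cosetOp_apply, Fin.ext_iff]

theorem cosetOp_gt {n i k : ℕ} (hi : i < n + 1) (v : Fin (n + 2) → Hecke a b n)
    (h : k < n + 2) (hk : i + 1 < k) :
    cosetOp n ⟨i, hi⟩ v ⟨k, h⟩ = hgn a b n i * v ⟨k, h⟩ := by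
  have h1 : k ≠ i + 1 := by omega
  have h2 : k ≠ i := by omega
  have h3 : i < k := by omega
  simp [cosetOp_apply, Fin.ext_iff, h1, h2, h3]

theorem cosetOp_lt {n i k : ℕ} (hi : i < n + 1) (v : Fin (n + 2) → Hecke a b n)
    (h : k < n + 2) (hk : k < i) :
    cosetOp n ⟨i, hi⟩ v ⟨k, h⟩ = hgn a b n (i - 1) * v ⟨k, h⟩ := by
  have h1 : k ≠ i + 1 := by omega
  have h2 : k ≠ i := by omega
  have h3 : ¬ i < k := by omega
  simp [cosetOp_apply, Fin.ext_iff, h1, h2, h3]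

theorem cosetOp_quad (n : ℕ) (i : Fin (n + 1)) :
    (cosetOp n i : Module.End R (Fin (n + 2) → Hecke a b n)) * cosetOp n i =
      a • cosetOp n i + b • 1 := by
  refine LinearMap.ext fun v => funext fun k => ?_
  obtain ⟨i, hi⟩ := i
  obtain ⟨k, hk⟩ := k
  simp only [Module.End.mul_apply, LinearMap.add_apply, LinearMap.smul_apply, Pi.add_apply,
    Pi.smul_apply, Module.End.one_apply]
  rcases lt_trichotomy k i with h | rfl | h
  · simp only [cosetOp_lt hi _ hk h]
    rw [← mul_assoc, hgn_quad (by omega)]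
    simp [add_mul]
  · simp only [cosetOp_one, cosetOp_two]
  · rcases Nat.eq_or_lt_of_le h with rfl | h
    · simp only [Nat.succ_eq_add_one, cosetOp_one, cosetOp_two]
    · simp only [cosetOp_gt hi _ hk h]
      rw [← mul_assoc, hgn_quad (by omega)]
      simp [add_mul]

theorem cosetOp_comm (n : ℕ) (i j : Fin (n + 1)) (h : (i : ℕ) + 1 < j) :
    (cosetOp n i : Module.End R (Fin (n + 2) → Hecke a b n)) * cosetOp n j =
      cosetOp n j * cosetOp n i := by
  refine LinearMap.ext fun v => funext fun k => ?_
  obtain ⟨i, hi⟩ := i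
  obtain ⟨j, hj⟩ := j
  obtain ⟨k, hk⟩ := k
  simp only at h
  simp only [Module.End.mul_apply]
  rcases (by omega : k < i ∨ k = i ∨ k = i + 1 ∨ (i + 1 < k ∧ k < j) ∨ k = j ∨ k = j + 1 ∨
    j + 1 < k) with h1 | rfl | rfl | ⟨h1, h2⟩ | rfl | rfl | h1
  · rw [cosetOp_lt hi _ hk h1, cosetOp_lt hj _ hk (by omega), cosetOp_lt hj _ hk (by omega),
      cosetOp_lt hi _ hk h1, ← mul_assoc, ← mul_assoc, hgn_comm _ _ _ (by omega)]
  · rw [cosetOp_two, cosetOp_lt hj _ hk (by omega), cosetOp_lt hj _ _ (by omega),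
      cosetOp_lt hj _ hk (by omega), cosetOp_two, mul_add, mul_smul_comm, mul_smul_comm]
  · rw [cosetOp_one, cosetOp_lt hj _ _ (by omega), cosetOp_lt hj _ _ (by omega), cosetOp_one]
  · rw [cosetOp_gt hi _ hk h1, cosetOp_lt hj _ hk h2, cosetOp_lt hj _ hk h2,
      cosetOp_gt hi _ hk h1, ← mul_assoc, ← mul_assoc, hgn_comm _ _ _ (by omega)]
  · rw [cosetOp_two, cosetOp_gt hi _ hk (by omega), cosetOp_two, cosetOp_gt hi _ _ (by omega),
      cosetOp_gt hi _ _ (by omega), mul_add, mul_smul_comm, mul_smul_comm]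
  · rw [cosetOp_one, cosetOp_gt hi _ _ (by omega), cosetOp_gt hi _ _ (by omega), cosetOp_one]
  · rw [cosetOp_gt hi _ hk (by omega), cosetOp_gt hj _ hk h1, cosetOp_gt hj _ hk h1,
      cosetOp_gt hi _ hk (by omega), ← mul_assoc, ← mul_assoc, hgn_comm _ _ _ (by omega)]

theorem cosetOp_braid (n : ℕ) (i j : Fin (n + 1)) (h : (i : ℕ) + 1 = j) :
    (cosetOp n i : Module.End R (Fin (n + 2) → Hecke a b n)) * cosetOp n j * cosetOp n i =
      cosetOp n j * cosetOp n i * cosetOp n j := by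
  refine LinearMap.ext fun v => funext fun k => ?_
  obtain ⟨i, hi⟩ := i
  obtain ⟨j, hj⟩ := j
  obtain ⟨k, hk⟩ := k
  simp only at h
  subst h
  simp only [Module.End.mul_apply]
  rcases (by omega : k < i ∨ k = i ∨ k = i + 1 ∨ k = i + 1 + 1 ∨ i + 1 + 1 < k) with
    h1 | rfl | rfl | rfl | h1
  · obtain ⟨s, rfl⟩ : ∃ s, i = s + 1 := ⟨i - 1, by omega⟩
    simp only [cosetOp_lt hi _ hk h1, cosetOp_lt hj _ hk (by omega : k < s + 1 + 1),
      Nat.add_sub_cancel, ← mul_assoc, hgn_braid]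
  · simp only [cosetOp_one, cosetOp_two, cosetOp_lt hj _ hk (by omega : k < k + 1),
      cosetOp_gt hi _ _ (by omega : k + 1 < k + 1 + 1), Nat.add_sub_cancel, mul_add,
      mul_smul_comm]
    rw [← mul_assoc, hgn_quad (by omega)]
    simp only [add_mul, smul_mul_assoc, one_mul, smul_add, smul_comm b a]
    abel
  · simp only [cosetOp_one, cosetOp_two, cosetOp_lt hj _ (by omega : i < n + 2)
      (by omega : i < i + 1), cosetOp_gt hi _ (by omega : i + 1 + 1 < n + 2) (by omega : i + 1 < i + 1 + 1),
      Nat.add_sub_cancel, mul_add, mul_smul_comm]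
  · simp only [cosetOp_one, cosetOp_gt hi _ hk (by omega : i + 1 < i + 1 + 1),
      cosetOp_lt hj _ (by omega : i < n + 2) (by omega : i < i + 1), Nat.add_sub_cancel]
  · simp only [cosetOp_gt hi _ hk (by omega : i + 1 < k), cosetOp_gt hj _ hk h1, ← mul_assoc,
      hgn_braid]

/-- The Hecke algebra acting on coordinate vectors with respect to the coset basis. -/
noncomputable def cosetRep (n : ℕ) :
    Hecke a b (n + 1) →ₐ[R] Module.End R (Fin (n + 2) → Hecke a b n) :=
  heckeLift (cosetOp n) (cosetOp_comm n) (cosetOp_braid n) (cosetOp_quad n)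

@[simp] theorem cosetRep_hg (n : ℕ) (i : Fin (n + 1)) :
    cosetRep n (hg a b i) = cosetOp n i := by simp [cosetRep]

theorem dprod_mul_hgn {n k i : ℕ} (hk : k ≤ n) (hi : i < n) :
    dprod (hgn a b n) k (n - k) * hgn a b n i =
      if k = i + 1 then dprod (hgn a b n) i (n - i)
      else if k = i then a • dprod (hgn a b n) k (n - k) +
        b • dprod (hgn a b n) (k + 1) (n - (k + 1))
      else if i < k then hgn a b n i * dprod (hgn a b n) k (n - k)
      else hgn a b n (i - 1) * dprod (hgn a b n) k (n - k) := by
  split_ifs with h1 h2 h3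
  · subst h1
    rw [show n - i = (n - (i + 1)) + 1 by omega, dprod_bottom]
  · subst h2
    rw [show n - k = (n - (k + 1)) + 1 by omega, dprod_bottom, mul_assoc, hgn_quad hi]
    simp [mul_add]
  · exact dprod_comm _ (hgn_comm n) _ _ _ (by omega)
  · obtain ⟨j, rfl⟩ : ∃ j, i = j + 1 := ⟨i - 1, by omega⟩
    exact dprod_shift _ (hgn_comm n) (hgn_braid n) _ _ _ (by omega) (by omega)

/-- The values of the conditional expectation on the coset basis. -/
noncomputable def cvec (μ : R) (n : ℕ) (k : Fin (n + 2)) : Hecke a b n :=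
  if (k : ℕ) ≤ n then dprod (hgn a b n) k (n - k) else algebraMap R _ μ

theorem cosetOp_cvec (μ : R) {n : ℕ} (i : Fin n) (k : Fin (n + 2)) :
    cosetOp n i.castSucc (cvec (a := a) (b := b) μ n) k = cvec μ n k * hg a b i := by
  obtain ⟨i, hi⟩ := i
  obtain ⟨k, hk⟩ := k
  rw [← hgn_val]
  by_cases hkn : k ≤ n
  · have hki : k = i → k + 1 ≤ n := by omega
    have hi' : i ≤ n := by omega
    rw [cosetOp_apply]
    simp only [cvec, hkn, if_true, dprod_mul_hgn hkn hi, Fin.ext_iff, Fin.val_succ,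
      hi', Fin.castSucc_mk]
    by_cases h1 : k = i + 1
    · simp [h1]
    · by_cases h2 : k = i
      · have hi2 : i + 1 ≤ n := hi
        simp [h2, hi2]
      · simp [h1, h2]
  · have : ¬ k ≤ n := hkn
    rw [show (Fin.castSucc ⟨i, hi⟩ : Fin (n + 1)) = ⟨i, by omega⟩ from rfl,
      cosetOp_gt _ _ _ (by omega)]
    simp only [cvec, this, if_false]
    exact (Algebra.commutes _ _).symm

theorem cosetRep_mul_right {n : ℕ} (y : Hecke a b (n + 1)) (v : Fin (n + 2) → Hecke a b n)
    (h : Hecke a b n) : cosetRep n y (fun k => v k * h) = fun k => cosetRep n y v k * h := by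
  revert v
  refine hecke_induction (fun y => ∀ v : Fin (n + 2) → Hecke a b n,
    cosetRep n y (fun k => v k * h) = fun k => cosetRep n y v k * h) (fun r v => ?_)
    (fun i v => ?_) (fun y z hy hz v => ?_) (fun y z hy hz v => ?_) y
  · funext k; simp [Module.algebraMap_end_apply]
  · funext k
    simp only [cosetRep_hg, cosetOp_apply]
    split_ifs <;> simp [add_mul, mul_assoc]
  · funext k; simp [hy, hz, add_mul]
  · rw [map_mul, Module.End.mul_apply, hz, hy]; rfl

theorem cosetRep_hInc_cvec (μ : R) {n : ℕ} (h : Hecke a b n) :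
    cosetRep n (hInc a b n h) (cvec μ n) = fun k => cvec μ n k * h := by
  refine hecke_induction (fun h => cosetRep n (hInc a b n h) (cvec μ n) =
    fun k => cvec μ n k * h) (fun r => ?_) (fun i => ?_) (fun y z hy hz => ?_)
    (fun y z hy hz => ?_) h
  · funext k; simp [Module.algebraMap_end_apply, Algebra.smul_def, Algebra.commutes]
  · funext k; rw [hInc_hg, cosetRep_hg, cosetOp_cvec]
  · funext k; simp [hy, hz, mul_add]
  · rw [map_mul, map_mul, Module.End.mul_apply, hz, cosetRep_mul_right, hy]
    simp only [mul_assoc]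

theorem cosetRep_hInc_last {n : ℕ} (h : Hecke a b n) (v : Fin (n + 2) → Hecke a b n) :
    cosetRep n (hInc a b n h) v (Fin.last _) = h * v (Fin.last _) := by
  revert v
  refine hecke_induction (fun h => ∀ v : Fin (n + 2) → Hecke a b n,
    cosetRep n (hInc a b n h) v (Fin.last _) = h * v (Fin.last _)) (fun r v => ?_)
    (fun i v => ?_) (fun y z hy hz v => ?_) (fun y z hy hz v => ?_) h
  · simp [Module.algebraMap_end_apply, Algebra.smul_def]
  · rw [hInc_hg, cosetRep_hg, ← hgn_val]
    exact cosetOp_gt (i := i) (k := n + 1) (by omega) v (by omega) (by omega)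
  · simp [hy, hz, add_mul]
  · rw [map_mul, map_mul, Module.End.mul_apply, hy, hz, mul_assoc]

variable (a b) in
/-- The conditional expectation `H_{n+1} → H_n`. -/
noncomputable def condExp (μ : R) (n : ℕ) : Hecke a b (n + 1) →ₗ[R] Hecke a b n where
  toFun y := cosetRep n y (cvec μ n) (Fin.last _)
  map_add' y z := by simp
  map_smul' r y := by simp

theorem condExp_apply (μ : R) {n : ℕ} (y : Hecke a b (n + 1)) :
    condExp a b μ n y = cosetRep n y (cvec μ n) (Fin.last _) := rfl

theorem condExp_left (μ : R) {n : ℕ} (h : Hecke a b n) (y : Hecke a b (n + 1)) :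
    condExp a b μ n (hInc a b n h * y) = h * condExp a b μ n y := by
  rw [condExp_apply, map_mul, Module.End.mul_apply, cosetRep_hInc_last]; rfl

theorem condExp_right (μ : R) {n : ℕ} (h : Hecke a b n) (y : Hecke a b (n + 1)) :
    condExp a b μ n (y * hInc a b n h) = condExp a b μ n y * h := by
  rw [condExp_apply, map_mul, Module.End.mul_apply, cosetRep_hInc_cvec, cosetRep_mul_right]; rfl

theorem condExp_one (μ : R) {n : ℕ} : condExp a b μ n 1 = algebraMap R _ μ := by
  simp [condExp_apply, cvec]

theorem condExp_hInc (μ : R) {n : ℕ} (h : Hecke a b n) :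
    condExp a b μ n (hInc a b n h) = μ • h := by
  rw [← mul_one (hInc a b n h), condExp_left, condExp_one, ← Algebra.commutes, Algebra.smul_def]

theorem condExp_last (μ : R) (n : ℕ) : condExp a b μ n (hg a b (Fin.last n)) = 1 := by
  rw [condExp_apply, cosetRep_hg]
  refine (cosetOp_one (i := n) (by omega) _ (by omega)).trans ?_
  simp [cvec, dprod]

theorem hInc_dprod {n k t : ℕ} (h : k + t ≤ n) :
    hInc a b n (dprod (hgn a b n) k t) = dprod (hgn a b (n + 1)) k t := by
  induction t with
  | zero => simp [dprod]
  | succ t ih => rw [dprod, map_mul, ih (by omega), hInc_hgn (by omega), dprod]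

theorem hInc_hgn_mul {n i : ℕ} (h : i < n) (y : Hecke a b n) (z : Hecke a b (n + 1)) :
    hInc a b n y * (hgn a b (n + 1) i * z) = hInc a b n (y * hgn a b n i) * z := by
  rw [map_mul, hInc_hgn h, mul_assoc]

theorem mem_closure_coset {n : ℕ} (y : Hecke a b (n + 1)) :
    y ∈ AddSubmonoid.closure {z : Hecke a b (n + 1) | ∃ (h : Hecke a b n) (k : ℕ), k ≤ n + 1 ∧
      z = hInc a b n h * dprod (hgn a b (n + 1)) k (n + 1 - k)} := by
  set M := AddSubmonoid.closure {z : Hecke a b (n + 1) | ∃ (h : Hecke a b n) (k : ℕ), k ≤ n + 1 ∧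
      z = hInc a b n h * dprod (hgn a b (n + 1)) k (n + 1 - k)} with hM
  have key : ∀ (h : Hecke a b n) (k : ℕ), k ≤ n + 1 →
      hInc a b n h * dprod (hgn a b (n + 1)) k (n + 1 - k) ∈ M := fun h k hk =>
    AddSubmonoid.subset_closure ⟨h, k, hk, rfl⟩
  have main : ∀ z ∈ M, z * y ∈ M := by
    refine hecke_induction (fun y => ∀ z ∈ M, z * y ∈ M) (fun r z hz => ?_) (fun i z hz => ?_)
      (fun y y' hy hy' z hz => ?_) (fun y y' hy hy' z hz => ?_) y
    · induction hz using AddSubmonoid.closure_induction with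
      | mem z hz =>
        obtain ⟨h, k, hk, rfl⟩ := hz
        rw [← Algebra.commutes, ← Algebra.smul_def, ← smul_mul_assoc, ← map_smul]
        exact key _ _ hk
      | zero => simp
      | add z z' _ _ hz hz' => rw [add_mul]; exact add_mem hz hz'
    · induction hz using AddSubmonoid.closure_induction with
      | mem z hz =>
        obtain ⟨h, k, hk, rfl⟩ := hz
        have hi := i.isLt
        rw [← hgn_val, mul_assoc, dprod_mul_hgn hk hi]
        split_ifs with h1 h2 h3
        · exact key _ _ (by omega)
        · rw [mul_add, mul_smul_comm, mul_smul_comm, ← smul_mul_assoc, ← smul_mul_assoc,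
            ← map_smul, ← map_smul]
          exact add_mem (key _ _ hk) (key _ _ (by omega))
        · rw [hInc_hgn_mul (by omega)]; exact key _ _ hk
        · rw [hInc_hgn_mul (by omega)]; exact key _ _ hk
      | zero => simp
      | add z z' _ _ hz hz' => rw [add_mul]; exact add_mem hz hz'
    · rw [mul_add]; exact add_mem (hy z hz) (hy' z hz)
    · rw [← mul_assoc]; exact hy' _ (hy z hz)
  have h1 : (1 : Hecke a b (n + 1)) ∈ M := by
    have := key 1 (n + 1) le_rfl
    simpa [dprod] using this
  simpa using main 1 h1

/-- Every element of `H_{n+1}` is a sum of elements of `H_n` and of `H_n g_n H_n`. -/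
theorem hecke_succ_induction {n : ℕ} (p : Hecke a b (n + 1) → Prop)
    (hadd : ∀ y z, p y → p z → p (y + z)) (h0 : ∀ h, p (hInc a b n h))
    (h1 : ∀ h h', p (hInc a b n h * hg a b (Fin.last n) * hInc a b n h'))
    (y : Hecke a b (n + 1)) : p y := by
  induction mem_closure_coset y using AddSubmonoid.closure_induction with
  | mem z hz =>
    obtain ⟨h, k, hk, rfl⟩ := hz
    rcases Nat.le_succ_iff.mp hk with hk' | rfl
    · rw [show n + 1 - k = (n - k) + 1 by omega, dprod, ← hInc_dprod (by omega), ← mul_assoc,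
        show k + (n - k) = ((Fin.last n : Fin (n + 1)) : ℕ) by simp; omega, hgn_val]
      exact h1 _ _
    · simpa [dprod] using h0 h
  | zero => simpa using h0 0
  | add z z' _ _ hz hz' => exact hadd _ _ hz hz'

theorem hecke_zero_eq (h : Hecke a b 0) : ∃ r, h = algebraMap R _ r := by
  refine hecke_induction (fun h => ∃ r, h = algebraMap R _ r) (fun r => ⟨r, rfl⟩)
    (fun i => i.elim0) ?_ ?_ h
  · rintro _ _ ⟨r, rfl⟩ ⟨s, rfl⟩; exact ⟨r + s, by simp⟩
  · rintro _ _ ⟨r, rfl⟩ ⟨s, rfl⟩; exact ⟨r * s, by simp⟩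

/-- Elements of `H_n` commute with the generator `g_{n+1}`. -/
theorem hInc_hInc_comm {n : ℕ} (h : Hecke a b n) :
    hInc a b (n + 1) (hInc a b n h) * hg a b (Fin.last (n + 1)) =
      hg a b (Fin.last (n + 1)) * hInc a b (n + 1) (hInc a b n h) := by
  refine hecke_induction (fun h => hInc a b (n + 1) (hInc a b n h) * hg a b (Fin.last (n + 1)) =
      hg a b (Fin.last (n + 1)) * hInc a b (n + 1) (hInc a b n h)) (fun r => ?_) (fun i => ?_)
    (fun y z hy hz => ?_) (fun y z hy hz => ?_) h
  · simp [Algebra.commutes]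
  · rw [hInc_hg, hInc_hg]; exact hg_comm _ _ (by simp)
  · simp only [map_add, add_mul, mul_add, hy, hz]
  · rw [map_mul, map_mul, mul_assoc, hz, ← mul_assoc, hy, mul_assoc]

theorem condExp_conj {μ : R} {n : ℕ} (h : Hecke a b (n + 1)) :
    condExp a b μ (n + 1) (hg a b (Fin.last (n + 1)) * hInc a b (n + 1) h *
      hg a b (Fin.last (n + 1))) = a • h + b • hInc a b n (condExp a b μ n h) := by
  refine hecke_succ_induction (fun h => condExp a b μ (n + 1) (hg a b (Fin.last (n + 1)) *
    hInc a b (n + 1) h * hg a b (Fin.last (n + 1))) =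
      a • h + b • hInc a b n (condExp a b μ n h)) (fun y z hy hz => ?_) (fun h => ?_)
    (fun h h' => ?_) h
  · simp only [map_add, mul_add, add_mul, hy, hz, smul_add]; abel
  · rw [← hInc_hInc_comm, mul_assoc, hg_quad, condExp_left, map_add, map_smul, map_smul,
      condExp_last, condExp_one, condExp_hInc, map_smul, mul_add, mul_smul_comm, mul_one,
      mul_smul_comm, ← Algebra.commutes, ← Algebra.smul_def]
  · have e : hg a b (Fin.last (n + 1)) * hInc a b (n + 1) (hInc a b n h * hg a b (Fin.last n) *
        hInc a b n h') * hg a b (Fin.last (n + 1)) =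
        hInc a b (n + 1) (hInc a b n h * hg a b (Fin.last n)) * hg a b (Fin.last (n + 1)) *
          hInc a b (n + 1) (hg a b (Fin.last n) * hInc a b n h') := by
      have hb := hg_braid (a := a) (b := b) (Fin.last n).castSucc (Fin.last (n + 1)) (by simp)
      simp only [map_mul, hInc_hg]
      have c1 := hInc_hInc_comm h
      have c2 := hInc_hInc_comm h'
      generalize hInc a b (n + 1) (hInc a b n h) = u at c1 ⊢
      generalize hInc a b (n + 1) (hInc a b n h') = v at c2 ⊢
      generalize hg a b (Fin.last n).castSucc = e at hb ⊢
      generalize hg a b (Fin.last (n + 1)) = f at hb c1 c2 ⊢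
      calc f * (u * e * v) * f = (f * u) * e * (v * f) := by simp only [mul_assoc]
        _ = u * (f * e * f) * v := by rw [c2, ← c1]; simp only [mul_assoc]
        _ = u * e * f * (e * v) := by rw [← hb]; simp only [mul_assoc]
    rw [e, condExp_right, condExp_left, condExp_last, mul_one, condExp_right, condExp_left,
      condExp_last, mul_one, ← mul_assoc, mul_assoc _ (hg a b _) (hg a b _), hg_quad]
    simp [mul_add, add_mul]

variable (a b) in
/-- The Ocneanu trace, normalized so that it is unchanged by stabilizations. -/
noncomputable def tr (μ : R) : (n : ℕ) → Hecke a b n →ₗ[R] R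
  | 0 => (heckeLift (A := R) (fun i => i.elim0) (fun i => i.elim0) (fun i => i.elim0)
      (fun i => i.elim0)).toLinearMap
  | n + 1 => tr μ n ∘ₗ condExp a b μ n

theorem tr_zero_one (μ : R) : tr a b μ 0 1 = 1 := by simp [tr]

theorem tr_succ (μ : R) {n : ℕ} (y : Hecke a b (n + 1)) :
    tr a b μ (n + 1) y = tr a b μ n (condExp a b μ n y) := rfl

theorem tr_mul_comm (μ : R) (n : ℕ) (y z : Hecke a b n) :
    tr a b μ n (y * z) = tr a b μ n (z * y) := by
  induction n with
  | zero =>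
    obtain ⟨r, rfl⟩ := hecke_zero_eq y
    rw [Algebra.commutes]
  | succ n ih =>
    revert y
    refine hecke_induction (fun z => ∀ y, tr a b μ (n + 1) (y * z) = tr a b μ (n + 1) (z * y))
      (fun r y => by rw [Algebra.commutes]) (fun i => ?_)
      (fun z z' hz hz' y => by simp only [mul_add, add_mul, map_add, hz, hz'])
      (fun z z' hz hz' y => by rw [← mul_assoc, hz', ← mul_assoc, hz, mul_assoc]) z
    induction i using Fin.lastCases with
    | cast i =>
      intro y
      rw [← hInc_hg, tr_succ, tr_succ, condExp_left, condExp_right, ih]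
    | last =>
      intro y
      refine hecke_succ_induction (fun y => tr a b μ (n + 1) (y * hg a b (Fin.last n)) =
        tr a b μ (n + 1) (hg a b (Fin.last n) * y)) (fun y z hy hz => ?_) (fun h => ?_)
        (fun h h' => ?_) y
      · simp only [mul_add, add_mul, map_add, hy, hz]
      · rw [tr_succ, tr_succ, condExp_left, condExp_right, condExp_last, mul_one, one_mul]
      · cases n with
        | zero =>
          obtain ⟨r, rfl⟩ := hecke_zero_eq h
          obtain ⟨s, rfl⟩ := hecke_zero_eq h'
          congr 1
          simp only [AlgHom.commutes, ← Algebra.commutes s, ← Algebra.smul_def, smul_mul_assoc,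
            mul_smul_comm]
        | succ n =>
          have e1 : tr a b μ (n + 2) (hInc a b (n + 1) h * hg a b (Fin.last (n + 1)) *
              hInc a b (n + 1) h' * hg a b (Fin.last (n + 1))) =
              tr a b μ (n + 1) (h * (a • h' + b • hInc a b n (condExp a b μ n h'))) := by
            rw [mul_assoc, mul_assoc, ← mul_assoc (hg a b _), tr_succ, condExp_left,
              condExp_conj]
          have e2 : tr a b μ (n + 2) (hg a b (Fin.last (n + 1)) * (hInc a b (n + 1) h *
              hg a b (Fin.last (n + 1)) * hInc a b (n + 1) h')) =
              tr a b μ (n + 1) ((a • h + b • hInc a b n (condExp a b μ n h)) * h') := by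
            rw [← mul_assoc, ← mul_assoc, tr_succ, condExp_right, condExp_conj]
          rw [e1, e2]
          simp only [mul_add, add_mul, map_add, mul_smul_comm, smul_mul_assoc, map_smul, tr_succ,
            condExp_right, condExp_left]

section Braids

variable {b' : R} (hb : b * b' = 1)

variable (a) in
/-- The generators of the Hecke algebra are invertible. -/
noncomputable def hUnit {n : ℕ} (i : Fin n) : (Hecke a b n)ˣ where
  val := hg a b i
  inv := b' • (hg a b i - a • 1)
  val_inv := by
    rw [mul_smul_comm, mul_sub, hg_quad, mul_smul_comm, mul_one, add_sub_cancel_left, smul_smul,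
      mul_comm, hb, one_smul]
  inv_val := by
    rw [smul_mul_assoc, sub_mul, hg_quad, smul_mul_assoc, one_mul, add_sub_cancel_left, smul_smul,
      mul_comm, hb, one_smul]

variable (a) in
/-- The homomorphism from the braid group to the units of the Hecke algebra. -/
noncomputable def braidUnit (n : ℕ) : Braid n →* (Hecke a b n)ˣ :=
  braidLift (hUnit a hb) (fun i j h => Units.ext (hg_comm i j h))
    (fun i j h => Units.ext (hg_braid i j h))

theorem braidUnit_x {n : ℕ} (i : Fin n) :
    ((braidUnit a hb n (x i) : (Hecke a b n)ˣ) : Hecke a b n) = hg a b i := by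
  rw [braidUnit, braidLift_x]; rfl

theorem braidUnit_x_inv {n : ℕ} (i : Fin n) :
    ((braidUnit a hb n (x i)⁻¹ : (Hecke a b n)ˣ) : Hecke a b n) =
      b' • (hg a b i - a • 1) := by
  rw [map_inv, braidUnit, braidLift_x]; rfl

theorem braidUnit_addStrand {n : ℕ} (β : Braid n) :
    ((braidUnit a hb (n + 1) (addStrand n β) : (Hecke a b (n + 1))ˣ) : Hecke a b (n + 1)) =
      hInc a b n (braidUnit a hb n β : (Hecke a b n)ˣ) := by
  have : (braidUnit a hb (n + 1)).comp (addStrand n) =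
      (Units.map (hInc a b n : Hecke a b n →* Hecke a b (n + 1))).comp (braidUnit a hb n) := by
    refine PresentedGroup.ext fun i => Units.ext ?_
    change ((braidUnit a hb (n + 1) (addStrand n (x i)) : (Hecke a b (n + 1))ˣ) :
      Hecke a b (n + 1)) = hInc a b n (braidUnit a hb n (x i) : (Hecke a b n)ˣ)
    rw [addStrand_x, braidUnit_x, braidUnit_x, hInc_hg]
  exact congrArg Units.val (DFunLike.congr_fun this β)

theorem mem_span_braidUnit {n : ℕ} (y : Hecke a b n) :
    y ∈ Submodule.span R
      (Set.range fun β : Braid n => ((braidUnit a hb n β : (Hecke a b n)ˣ) : Hecke a b n)) := by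
  have key : ∀ β : Braid n, ((braidUnit a hb n β : (Hecke a b n)ˣ) : Hecke a b n) ∈
      Submodule.span R (Set.range fun β : Braid n =>
        ((braidUnit a hb n β : (Hecke a b n)ˣ) : Hecke a b n)) := fun β =>
    Submodule.subset_span ⟨β, rfl⟩
  refine hecke_induction (fun y => y ∈ Submodule.span R (Set.range fun β : Braid n =>
    ((braidUnit a hb n β : (Hecke a b n)ˣ) : Hecke a b n))) (fun r => ?_) (fun i => ?_)
    (fun y z hy hz => add_mem hy hz) (fun y z hy hz => ?_) y
  · rw [Algebra.algebraMap_eq_smul_one]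
    exact Submodule.smul_mem _ _ (by simpa using key 1)
  · rw [← braidUnit_x hb]; exact key _
  · induction hy using Submodule.span_induction with
    | mem y hy =>
      obtain ⟨β, rfl⟩ := hy
      induction hz using Submodule.span_induction with
      | mem z hz =>
        obtain ⟨γ, rfl⟩ := hz
        simpa using key (β * γ)
      | zero => simp
      | add z z' _ _ h h' => rw [mul_add]; exact add_mem h h'
      | smul r z _ h => rw [mul_smul_comm]; exact Submodule.smul_mem _ _ h
    | zero => simp
    | add z z' _ _ h h' => rw [add_mul]; exact add_mem h h'
    | smul r z _ h => rw [smul_mul_assoc]; exact Submodule.smul_mem _ _ h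

variable (μ : R)

variable (a) in
/-- The trace of a braid. -/
noncomputable def braidTr (β : Σ n, Braid n) : R :=
  tr a b μ β.1 (braidUnit a hb β.1 β.2 : (Hecke a b β.1)ˣ)

theorem braidTr_markov (hμ : a * μ = 1 - b) {β γ : Σ n, Braid n} (h : MarkovMove β γ) :
    braidTr a hb μ β = braidTr a hb μ γ := by
  cases h with
  | conj α β =>
    simp only [braidTr]
    rw [map_mul, map_mul, Units.val_mul, tr_mul_comm, ← Units.val_mul, ← mul_assoc, map_inv,
      inv_mul_cancel, one_mul]
  | stab β =>
    simp only [braidTr]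
    rw [map_mul, Units.val_mul, braidUnit_addStrand, braidUnit_x, tr_succ, condExp_left,
      condExp_last, mul_one]
  | stabInv β =>
    simp only [braidTr]
    rw [map_mul, Units.val_mul, braidUnit_addStrand, braidUnit_x_inv, tr_succ, condExp_left,
      map_smul, map_sub, map_smul, condExp_last, condExp_one, Algebra.algebraMap_eq_smul_one,
      smul_smul, hμ, sub_smul, one_smul, sub_sub_cancel, smul_smul, mul_comm b', hb, one_smul,
      mul_one]

theorem braidTr_one : braidTr a hb μ ⟨0, 1⟩ = 1 := by
  simp only [braidTr]
  rw [map_one, Units.val_one, tr_zero_one]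

theorem braidTr_skein {n : ℕ} (i : Fin n) (α β : Braid n) :
    braidTr a hb μ ⟨n, α * (x i)⁻¹ * β⟩ =
      b' * (braidTr a hb μ ⟨n, α * x i * β⟩ - a * braidTr a hb μ ⟨n, α * β⟩) := by
  simp only [braidTr]
  rw [map_mul, map_mul, map_mul _ (α * x i), map_mul _ α (x i), map_mul _ α β, Units.val_mul,
    Units.val_mul, Units.val_mul, Units.val_mul, Units.val_mul, braidUnit_x, braidUnit_x_inv]
  simp only [mul_smul_comm, smul_mul_assoc, mul_sub, sub_mul, map_smul, map_sub, mul_one,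
    smul_eq_mul]

variable (a b) in
/-- The functions on a braid group that satisfy the skein relation. -/
def skeinFun (n : ℕ) : Submodule R (Braid n → R) where
  carrier := {f | ∀ (i : Fin n) (α β : Braid n),
    f (α * x i * x i * β) = a * f (α * x i * β) + b * f (α * β)}
  add_mem' hf hg' i α β := by simp only [Pi.add_apply, hf i α β, hg' i α β]; ring
  zero_mem' i α β := by simp
  smul_mem' r f hf i α β := by simp only [Pi.smul_apply, smul_eq_mul, hf i α β]; ring

/-- Translation of functions on a braid group. -/
def translate {n : ℕ} (γ : Braid n) : Module.End R (skeinFun a b n) where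
  toFun f := ⟨fun β => f.1 (β * γ), fun i α β => by
    have := f.2 i α (β * γ)
    simpa only [mul_assoc] using this⟩
  map_add' f g := rfl
  map_smul' r f := rfl

theorem translate_mul {n : ℕ} (γ δ : Braid n) :
    (translate (γ * δ) : Module.End R (skeinFun a b n)) = translate γ * translate δ := by
  refine LinearMap.ext fun f => Subtype.ext (funext fun β => ?_)
  simp [translate, mul_assoc]

theorem translate_one (n : ℕ) :
    (translate (1 : Braid n) : Module.End R (skeinFun a b n)) = 1 :=
  LinearMap.ext fun f => Subtype.ext (funext fun β => by simp [translate])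

theorem translate_quad {n : ℕ} (i : Fin n) :
    (translate (x i) : Module.End R (skeinFun a b n)) * translate (x i) =
      a • translate (x i) + b • 1 := by
  refine LinearMap.ext fun f => Subtype.ext (funext fun β => ?_)
  have := f.2 i β 1
  simp only [mul_one] at this
  exact this

theorem translate_comm {n : ℕ} (i j : Fin n) (h : (i : ℕ) + 1 < j) :
    (translate (x i) : Module.End R (skeinFun a b n)) * translate (x j) =
      translate (x j) * translate (x i) := by
  rw [← translate_mul, x_comm i j h, translate_mul]

theorem translate_braid {n : ℕ} (i j : Fin n) (h : (i : ℕ) + 1 = j) :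
    (translate (x i) : Module.End R (skeinFun a b n)) * translate (x j) * translate (x i) =
      translate (x j) * translate (x i) * translate (x j) := by
  rw [← translate_mul, ← translate_mul, x_braid i j h, translate_mul, translate_mul]

variable (a b) in
/-- The Hecke algebra acts on the functions that satisfy the skein relation. -/
noncomputable def skeinRep (n : ℕ) : Hecke a b n →ₐ[R] Module.End R (skeinFun a b n) :=
  heckeLift (A := Module.End R (skeinFun a b n)) (fun i => translate (x i)) translate_comm translate_braid translate_quad

/-- Translations as a group homomorphism. -/
def translateHom (n : ℕ) : Braid n →* Module.End R (skeinFun a b n) where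
  toFun := translate
  map_one' := translate_one n
  map_mul' := translate_mul

theorem skeinRep_braidUnit {n : ℕ} (β : Braid n) :
    skeinRep a b n (braidUnit a hb n β : (Hecke a b n)ˣ) = translate β := by
  have key : (Units.map (skeinRep a b n : Hecke a b n →* Module.End R (skeinFun a b n))).comp
      (braidUnit a hb n) = MonoidHom.toHomUnits (translateHom n) := by
    refine PresentedGroup.ext fun i => Units.ext ?_
    change skeinRep a b n (braidUnit a hb n (x i) : (Hecke a b n)ˣ) = translate (x i)
    rw [braidUnit_x, skeinRep, heckeLift_hg]
  exact congrArg Units.val (DFunLike.congr_fun key β)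

/-- A function that satisfies the skein relation and vanishes on the braids of the forms `β` and
`β x_n γ` with `β`, `γ` on fewer strands is zero. -/
theorem skeinFun_eq_zero {b' : R} (hb : b * b' = 1) {n : ℕ} (f : skeinFun a b (n + 1))
    (h0 : ∀ β : Braid n, f.1 (addStrand n β) = 0)
    (h1 : ∀ β γ : Braid n, f.1 (addStrand n β * x (Fin.last n) * addStrand n γ) = 0)
    (β : Braid (n + 1)) : f.1 β = 0 := by
  have main : ∀ y : Hecke a b (n + 1), (skeinRep a b (n + 1) y f).1 1 = 0 := by
    refine hecke_succ_induction _ (fun y z hy hz => ?_) (fun h => ?_) (fun h h' => ?_)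
    · rw [map_add, LinearMap.add_apply, Submodule.coe_add, Pi.add_apply, hy, hz, add_zero]
    · induction mem_span_braidUnit hb h using Submodule.span_induction with
      | mem z hz =>
        obtain ⟨β, rfl⟩ := hz
        rw [← braidUnit_addStrand, skeinRep_braidUnit]
        simpa [translate] using h0 β
      | zero => simp
      | add z z' _ _ hz hz' => simp [hz, hz']
      | smul r z _ hz => simp [hz]
    · induction mem_span_braidUnit hb h using Submodule.span_induction with
      | mem z hz =>
        obtain ⟨β, rfl⟩ := hz
        induction mem_span_braidUnit hb h' using Submodule.span_induction with
        | mem z hz =>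
          obtain ⟨γ, rfl⟩ := hz
          rw [← braidUnit_addStrand, ← braidUnit_addStrand, ← braidUnit_x hb, ← Units.val_mul,
            ← map_mul, ← Units.val_mul, ← map_mul, skeinRep_braidUnit]
          simpa [translate] using h1 β γ
        | zero => simp
        | add z z' _ _ hz hz' => simp only [map_add, mul_add, LinearMap.add_apply,
            Submodule.coe_add, Pi.add_apply, hz, hz', add_zero]
        | smul r z _ hz => simp only [map_smul, mul_smul_comm, LinearMap.smul_apply,
            Submodule.coe_smul, Pi.smul_apply, hz, smul_zero]
      | zero => simp
      | add z z' _ _ hz hz' => simp only [map_add, add_mul, LinearMap.add_apply,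
            Submodule.coe_add, Pi.add_apply, hz, hz', add_zero]
      | smul r z _ hz => simp only [map_smul, smul_mul_assoc, LinearMap.smul_apply,
            Submodule.coe_smul, Pi.smul_apply, hz, smul_zero]
  have := main (braidUnit a hb (n + 1) β : (Hecke a b (n + 1))ˣ)
  rw [skeinRep_braidUnit] at this
  simpa [translate] using this

end Braids

end Hecke

theorem exists_isHomfly : ∃ P, IsHomfly P := by
  have e1 := l_mul_lInv
  have e2 := m_mul_mInv
  have hb : -(l * l) * -(lInv * lInv) = 1 := by linear_combination (l * lInv + 1) * e1
  have hμ : -(m * l) * -((l + lInv) * mInv) = 1 - -(l * l) := by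
    linear_combination (l * l + l * lInv) * e2 + e1
  refine ⟨Quot.lift (braidTr (-(m * l)) hb (-((l + lInv) * mInv)))
    (fun _ _ h => braidTr_markov hb _ hμ h), ?_, ?_⟩
  · exact braidTr_one hb _
  · intro n i α β
    have h := braidTr_skein (a := -(m * l)) hb (-((l + lInv) * mInv)) i α β
    simp only [closure]
    rw [h]
    linear_combination (-lInv * braidTr (-(m * l)) hb (-((l + lInv) * mInv)) ⟨n, α * x i * β⟩ -
      (l * lInv + 1) * m * braidTr (-(m * l)) hb (-((l + lInv) * mInv)) ⟨n, α * β⟩) * e1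

theorem closure_conj {n : ℕ} (α β : Braid n) : closure (α * β * α⁻¹) = closure β :=
  Quot.sound (MarkovMove.conj α β)

theorem closure_mul_comm {n : ℕ} (α β : Braid n) : closure (α * β) = closure (β * α) := by
  rw [← closure_conj β (α * β)]; simp [mul_assoc]

theorem closure_stab {n : ℕ} (β : Braid n) :
    closure (addStrand n β * x (Fin.last n)) = closure β := Quot.sound (MarkovMove.stab β)

theorem closure_stabInv {n : ℕ} (β : Braid n) :
    closure (addStrand n β * (x (Fin.last n))⁻¹) = closure β := Quot.sound (MarkovMove.stabInv β)

theorem isHomfly_unique {P Q : OrientedLink → Coeff} (hP : IsHomfly P) (hQ : IsHomfly Q) :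
    P = Q := by
  have e1 := l_mul_lInv
  have e2 := m_mul_mInv
  have hb : -(l * l) * -(lInv * lInv) = 1 := by linear_combination (l * lInv + 1) * e1
  have key : ∀ (n : ℕ) (β : Braid n), P (closure β) - Q (closure β) = 0 := by
    intro n
    induction n with
    | zero =>
      intro β
      have : β = 1 := by
        have h : (MonoidHom.id (Braid 0)) = 1 := PresentedGroup.ext fun i => i.elim0
        exact DFunLike.congr_fun h β
      rw [this, hP.unknot, hQ.unknot, sub_self]
    | succ n ih =>
      have hf : (fun β : Braid (n + 1) => P (closure β) - Q (closure β)) ∈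
          skeinFun (-(m * l)) (-(l * l)) (n + 1) := by
        intro i α β
        have h1 := hP.skein i (α * x i) β
        have h2 := hQ.skein i (α * x i) β
        rw [mul_inv_cancel_right] at h1 h2
        simp only
        linear_combination l * h1 - l * h2 - (P (closure (α * x i * x i * β)) -
          Q (closure (α * x i * x i * β))) * e1
      refine fun β => skeinFun_eq_zero hb ⟨_, hf⟩ (fun β => ?_) (fun β γ => ?_) β
      · have h1 := hP.skein (Fin.last n) (addStrand n β) 1
        have h2 := hQ.skein (Fin.last n) (addStrand n β) 1
        simp only [mul_one, closure_stab, closure_stabInv] at h1 h2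
        simp only
        linear_combination mInv * h1 - mInv * h2 - (mInv * (l + lInv)) * ih β -
          (P (closure (addStrand n β)) - Q (closure (addStrand n β))) * e2
      · simp only
        rw [closure_mul_comm, ← mul_assoc, ← map_mul, closure_stab]
        exact ih _
  funext L
  obtain ⟨⟨n, β⟩, rfl⟩ := Quot.exists_rep L
  exact sub_eq_zero.mp (key n β)

theorem existsUnique_isHomfly : ∃! P, IsHomfly P :=
  exists_isHomfly.elim fun P hP => ⟨P, hP, fun _ hQ => isHomfly_unique hQ hP⟩

/-- The HOMFLY polynomial of oriented links: the unique link invariant with values in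
`ℂ[l^{±1}, m^{±1}]` that satisfies the normalization and the skein relation. -/
noncomputable def homfly : OrientedLink → Coeff := existsUnique_isHomfly.choose

theorem isHomfly_homfly : IsHomfly homfly := existsUnique_isHomfly.choose_spec.1

/-- The braid `x_{i_1}^{a_1} x_{i_2}^{a_2} ⋯ x_{i_k}^{a_k}`. -/
def braidWord {n k : ℕ} (i : Fin k → Fin n) (a : Fin k → ℤ) : Braid n :=
  (List.ofFn fun t => x (i t) ^ a t).prod

/-- The HOMFLY polynomial `P(a_1, …, a_k)` of the closure of the braid
`x_{i_1}^{a_1} x_{i_2}^{a_2} ⋯ x_{i_k}^{a_k}`, for fixed generators `x_{i_1}, …, x_{i_k}`. -/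
noncomputable def homflyOfExponents {n k : ℕ} (i : Fin k → Fin n) (a : Fin k → ℤ) : Coeff :=
  homfly (closure (braidWord i a))

end Homfly

namespace Homfly

/-! The recurrence is the skein relation applied to one extra crossing placed next to a power of the
same generator. Freeze every exponent except the `j`-th. The braid is then `A * x ^ c * B`, where
`x` is the generator in position `j` and `A`, `B` collect the factors on its two sides and do not
involve `c`. Put a crossing between `A * x ^ (c + 1)` and `B`. A positive crossing is `x⁻¹` and
lowers the exponent to `c`, a negative one is `x` and raises it to `c + 2`, and smoothing it leaves
`c + 1`. So the three consecutive values of the sequence are exactly a skein triple: `l P(c) + l⁻¹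
P(c + 2) + m P(c + 1) = 0`. Multiplying by `l` clears `l⁻¹` and yields the stated relation.

Equivalently, as far as the polynomial of closures can tell, each generator satisfies `x² = -(m l) x
- l²`, the quadratic relation of the Hecke algebra, and the recurrence is this relation multiplied
by `x ^ c` and placed between `A` and `B`. Since the relation lives in a group, `c` may be any
integer, and negative or zero exponents need no separate case.

`exists_braidWord_update` provides `A` and `B`, and `homfly_closure_zpow_add_two` is the skein
computation. Existence and uniqueness of the polynomial matter only in making `homfly` meaningful:
of its properties, the argument uses the skein relation alone, neither the value at the unknot nor
invariance under Markov moves. -/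

/-- As a function of one exponent, a braid word has the form `A * x_{i_j} ^ c * B`. -/
theorem exists_braidWord_update {n k : ℕ} (i : Fin k → Fin n) (a : Fin k → ℤ) (j : Fin k) :
    ∃ A B : Braid n, ∀ c : ℤ, braidWord i (Function.update a j c) = A * x (i j) ^ c * B := by
  induction k with
  | zero => exact j.elim0
  | succ k ih =>
    -- Splitting off the leftmost factor reduces the claim to whether the varying exponent sits in
    -- this factor or in the shorter word that remains.
    have cons (b : Fin (k + 1) → ℤ) :
        braidWord i b = x (i 0) ^ b 0 * braidWord (i ∘ Fin.succ) (b ∘ Fin.succ) := by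
      simp [braidWord, List.ofFn_succ]
    cases j using Fin.cases with
    | zero =>
      -- The varying factor is leftmost, so nothing stands before it. The rest of the word is the
      -- same for all `c`, because updating at `0` leaves the entries at successor indices
      -- unchanged.
      refine ⟨1, braidWord (i ∘ Fin.succ) (a ∘ Fin.succ), fun c => ?_⟩
      rw [cons, one_mul, Function.update_self]
      congr 2
    | succ j =>
      obtain ⟨A, B, h⟩ := ih (i ∘ Fin.succ) (a ∘ Fin.succ) j
      -- The head has the fixed exponent `a 0` and is absorbed into the left-hand braid. Injectivity
      -- of `Fin.succ` turns the tail of the update at `j.succ` into the update of the tail at `j`,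
      -- to which the induction hypothesis applies.
      refine ⟨x (i 0) ^ a 0 * A, B, fun c => ?_⟩
      rw [cons, Function.update_of_ne (Fin.succ_ne_zero j).symm,
        Function.update_comp_eq_of_injective a (Fin.succ_injective k), h]
      simp only [Function.comp_apply, mul_assoc]

/-- The powers `c`, `c + 1`, `c + 2` of one generator in a fixed surrounding braid play the roles of
`L₊`, `L₀`, `L₋`, so this is the skein relation multiplied by `l`. -/
theorem homfly_closure_zpow_add_two {n : ℕ} (i : Fin n) (A B : Braid n) (c : ℤ) :
    homfly (closure (A * x i ^ (c + 2) * B)) + m * l * homfly (closure (A * x i ^ (c + 1) * B))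
      + l ^ 2 * homfly (closure (A * x i ^ c * B)) = 0 := by
  -- The middle exponent `c + 1` belongs to the smoothed braid; the two signs of the crossing then
  -- shift it down and up by one.
  have h := isHomfly_homfly.skein i (A * x i ^ (c + 1)) B
  rw [mul_assoc A _ (x i)⁻¹, mul_assoc A _ (x i), ← zpow_sub_one, ← zpow_add_one,
    add_sub_cancel_right, add_assoc c 1 1, one_add_one_eq_two] at h
  -- Multiplication by `l` leaves the coefficient `l * lInv` on the term with exponent `c + 2`; the
  -- second summand replaces it by `1`.
  linear_combination l * h - homfly (closure (A * x i ^ (c + 2) * B)) * l_mul_lInv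

theorem homflyOfExponents_recurrence {n k : ℕ} (i : Fin k → Fin n) (a : Fin k → ℤ) (j : Fin k) :
    homflyOfExponents i (Function.update a j (a j + 2))
      + m * l * homflyOfExponents i (Function.update a j (a j + 1))
      + l ^ 2 * homflyOfExponents i a = 0 := by
  obtain ⟨A, B, h⟩ := exists_braidWord_update i a j
  have h0 := h (a j)
  -- The unmodified exponent vector is its own update at `j` by `a j`, so all three braids share the
  -- same `A` and `B`.
  rw [Function.update_eq_self] at h0
  simp only [homflyOfExponents, h, h0]
  exact homfly_closure_zpow_add_two (i j) A B (a j)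

end Homfly

/-- Here `n` counts generators, so the braids have `n + 1` strands and every positive number of
strands occurs. The Fibonacci form is the first relation solved for its leading term, whose
coefficient is `1`; this accounts for the minus signs in both parameters. -/
theorem theorem1p1 (n k : ℕ) (i : Fin k → Fin n) :
    (∀ (a : Fin k → ℤ) (j : Fin k),
      Homfly.homflyOfExponents i (Function.update a j (a j + 2))
        + Homfly.m * Homfly.l * Homfly.homflyOfExponents i (Function.update a j (a j + 1))
        + Homfly.l ^ 2 * Homfly.homflyOfExponents i a = 0) ∧
    Homfly.IsMultipleFibonacci (-(Homfly.m * Homfly.l)) (-(Homfly.l ^ 2))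
      (Homfly.homflyOfExponents i) := by
  refine ⟨Homfly.homflyOfExponents_recurrence i, fun a j => ?_⟩
  linear_combination Homfly.homflyOfExponents_recurrence i a j
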